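/- Let $n\ge 2$ and let $\Omega_n=\{1<2<\cdots<n\}$. Transformations of $\Omega_n$ are composed from left to right. Let $\mathcal{IO}_n$ be the monoid of all order-preserving full transformations of $\Omega_n$ whose image is an interval (convex subset) of $\Omega_n$, and let $\mathcal{IM}_n$ be the monoid of all full transformations of $\Omega_n$ that are order-preserving or order-reversing and whose image is an interval. For $1\le i\le n-1$ let $a_i,b_i\in\mathcal{IO}_n$ be given by $$x a_i=\begin{cases}x & x\le i\\ x-1 & x>i\end{cases}\qquad x b_i=\begin{cases}x+1 & x\le i\\ x & x>i\end{cases}$$ and let $h\in\mathcal{IM}_n$ be given by $xh=n+1-x$. Let $A=\{a_1,\dots,a_{n-1}\}$, $B=\{b_1,\dots,b_{n-1}\}$ and $C=A\cup B\cup\{h\}$; these are used both as alphabets and as sets of transformations. A monoid $M$ is defined by the presentation $\langle X\mid R\rangle$ on generators from $M$ named by $X$ if there is an isomorphism from $X^*/{\sim_R}$ onto $M$ that sends the class of each letter to the generator it names, where $\sim_R$ is the congruence on the free monoid $X^*$ generated by the set $R\subseteq X^*\times X^*$. For a set $R$ of relations over $A\cup B$, let $\overline R$ be the set of relations over $C$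 consisting of $R$ together with - $(N_0)$ $h^2=1$; - $(N_1)$ $ha_i=b_{n-i}h$ for $1\le i\le n-1$; - $(N_2)$ $a_1^{n-1}h=b_{n-1}^{n-1}$. Then the $2n-1$ letters of $C$ name $2n-1$ distinct elements of $\mathcal{IM}_n$, and the following hold. 1. Let $R_0$ be the set consisting of the relations - $a_ia_j=a_{j+1}a_i$ for $1\le i\le j\le n-2$, and $a_ia_{n-1}=a_i$ for $1\le i\le n-1$; - $b_ib_j=b_{j-1}b_i$ for $2\le j\le i\le n-1$, and $b_ib_1=b_i$ for $1\le i\le n-1$; - $a_ib_j=b_ja_i$ for $1\le j<i\le n-1$; - $a_ib_{n-1}=b_i$ and $b_ia_1=a_i$ for $1\le i\le n-1$. Then $\mathcal{IO}_n$ is defined by $\langle A\cup B\mid R_0\rangle$, and $\mathcal{IM}_n$ is defined by the presentation $\langle C\mid\overline{R_0}\rangle$ on $2n-1$ generators and $\frac12(3n^2+n)$ relations. 2. More generally, for every presentation $\langle A\cup B\mid R\rangle$ of $\mathcal{IO}_n$ on the generators $A\cup B$, the monoid $\mathcal{IM}_n$ is defined by $\langle C\mid\overline R\rangle$, and $|\overline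 R|=|R|+n+1$. -/

import Mathlib

namespace IntervalMonoids

/-- The chain `1 < 2 < ⋯ < n`. -/
abbrev Chain (n : ℕ) : Type := Set.Icc 1 n

/-- The index set `{1, …, n - 1}`. -/
abbrev Idx (n : ℕ) : Type := Set.Ico 1 n

/-- The monoid of full transformations of the chain, composed from left to right
(the product of `α` and `β` applies `α` first). -/
abbrev Transf (n : ℕ) : Type := (Function.End (Chain n))ᵐᵒᵖ

/-- The transformation `α` as a function. -/
abbrev toFn {n : ℕ} (α : Transf n) : Chain n → Chain n := α.unop

/-- The function `f` as a transformation. -/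
abbrev ofFn {n : ℕ} (f : Chain n → Chain n) : Transf n := MulOpposite.op f

lemma ordConnected_range_comp {X : Type*} [LinearOrder X] {f g : X → X}
    (hf : (Set.range f).OrdConnected) (hg : (Set.range g).OrdConnected)
    (hm : Monotone g ∨ Antitone g) : (Set.range (g ∘ f)).OrdConnected := by
  constructor
  rintro _ ⟨x, rfl⟩ _ ⟨z, rfl⟩ y ⟨h1, h2⟩
  obtain ⟨w, rfl⟩ := hg.out ⟨f x, rfl⟩ ⟨f z, rfl⟩ ⟨h1, h2⟩
  simp only [Function.comp_apply] at h1 h2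
  have key : ∀ p q, f p ≤ w → w ≤ f q → g w ∈ Set.range (g ∘ f) := by
    intro p q hp hq
    obtain ⟨t, ht⟩ := hf.out ⟨p, rfl⟩ ⟨q, rfl⟩ ⟨hp, hq⟩
    exact ⟨t, by simp [ht]⟩
  rcases le_total (f x) w with hx | hx <;> rcases le_total (f z) w with hz | hz
  · rcases hm with hm | hm
    · exact ⟨z, le_antisymm (hm hz) h2⟩
    · exact ⟨x, le_antisymm h1 (hm hx)⟩
  · exact key x z hx hz
  · exact key z x hz hx
  · rcases hm with hm | hm
    · exact ⟨x, le_antisymm h1 (hm hx)⟩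
    · exact ⟨z, le_antisymm (hm hz) h2⟩

/-- The monoid `IO_n` of all order-preserving full transformations of the chain `1 < ⋯ < n`
whose image is an interval. -/
def OrdInt (n : ℕ) : Submonoid (Transf n) where
  carrier := {α | Monotone (toFn α) ∧ (Set.range (toFn α)).OrdConnected}
  one_mem' := by
    refine ⟨monotone_id, ?_⟩
    change (Set.range (id : Chain n → Chain n)).OrdConnected
    rw [Set.range_id]
    exact Set.ordConnected_univ
  mul_mem' := by
    rintro α β ⟨h1, h2⟩ ⟨h3, h4⟩
    exact ⟨h3.comp h1, ordConnected_range_comp (f := toFn α) (g := toFn β) h2 h4 (Or.inl h3)⟩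

/-- The monoid `IM_n` of all monotone (order-preserving or order-reversing) full transformations
of the chain `1 < ⋯ < n` whose image is an interval. -/
def MonInt (n : ℕ) : Submonoid (Transf n) where
  carrier := {α | (Monotone (toFn α) ∨ Antitone (toFn α)) ∧
    (Set.range (toFn α)).OrdConnected}
  one_mem' := by
    refine ⟨Or.inl monotone_id, ?_⟩
    change (Set.range (id : Chain n → Chain n)).OrdConnected
    rw [Set.range_id]
    exact Set.ordConnected_univ
  mul_mem' := by
    rintro α β ⟨h1, h2⟩ ⟨h3, h4⟩
    refine ⟨?_, ordConnected_range_comp (f := toFn α) (g := toFn β) h2 h4 h3⟩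
    rcases h1 with h1 | h1 <;> rcases h3 with h3 | h3
    · exact Or.inl (h3.comp h1)
    · exact Or.inr (h3.comp_monotone h1)
    · exact Or.inr (h3.comp_antitone h1)
    · exact Or.inl (h3.comp h1)

/-- `a_i` maps `x` to `x` if `x ≤ i` and to `x - 1` if `x > i`. -/
def aFn {n : ℕ} (i : Idx n) (x : Chain n) : Chain n :=
  ⟨if x.1 ≤ i.1 then x.1 else x.1 - 1, by
    have hx := x.2
    have hi := i.2
    simp only [Set.mem_Icc, Set.mem_Ico] at *
    split_ifs <;> omega⟩

/-- `b_i` maps `x` to `x + 1` if `x ≤ i` and to `x` if `x > i`. -/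
def bFn {n : ℕ} (i : Idx n) (x : Chain n) : Chain n :=
  ⟨if x.1 ≤ i.1 then x.1 + 1 else x.1, by
    have hx := x.2
    have hi := i.2
    simp only [Set.mem_Icc, Set.mem_Ico] at *
    split_ifs <;> omega⟩

/-- `h` is the reflection `x ↦ n + 1 - x`. -/
def hFn {n : ℕ} (x : Chain n) : Chain n :=
  ⟨n + 1 - x.1, by
    have hx := x.2
    simp only [Set.mem_Icc] at *
    omega⟩

lemma aFn_val {n : ℕ} (i : Idx n) (x : Chain n) :
    (aFn i x).1 = if x.1 ≤ i.1 then x.1 else x.1 - 1 := rfl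

lemma bFn_val {n : ℕ} (i : Idx n) (x : Chain n) :
    (bFn i x).1 = if x.1 ≤ i.1 then x.1 + 1 else x.1 := rfl

lemma hFn_val {n : ℕ} (x : Chain n) : (hFn x).1 = n + 1 - x.1 := rfl

lemma aFn_monotone {n : ℕ} (i : Idx n) : Monotone (aFn i) := by
  intro x y hxy
  have hxy' : x.1 ≤ y.1 := hxy
  rw [← Subtype.coe_le_coe, aFn_val, aFn_val]
  split_ifs <;> omega

lemma bFn_monotone {n : ℕ} (i : Idx n) : Monotone (bFn i) := by
  intro x y hxy
  have hxy' : x.1 ≤ y.1 := hxy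
  rw [← Subtype.coe_le_coe, bFn_val, bFn_val]
  split_ifs <;> omega

lemma hFn_antitone {n : ℕ} : Antitone (hFn (n := n)) := by
  intro x y hxy
  have hxy' : x.1 ≤ y.1 := hxy
  rw [← Subtype.coe_le_coe, hFn_val, hFn_val]
  omega

lemma aFn_ordConnected {n : ℕ} (i : Idx n) : (Set.range (aFn i)).OrdConnected := by
  constructor
  rintro _ - _ ⟨z, rfl⟩ y ⟨-, h2⟩
  have h2' : y.1 ≤ (aFn i z).1 := h2
  rw [aFn_val] at h2'
  have hi := Set.mem_Ico.1 i.2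
  have hy := Set.mem_Icc.1 y.2
  have hz := Set.mem_Icc.1 z.2
  by_cases h : y.1 ≤ i.1
  · refine ⟨y, Subtype.ext ?_⟩
    rw [aFn_val, if_pos h]
  · have hy1 : y.1 + 1 ≤ n := by
      split_ifs at h2' <;> omega
    refine ⟨⟨y.1 + 1, Set.mem_Icc.2 ⟨by omega, hy1⟩⟩, Subtype.ext ?_⟩
    rw [aFn_val, if_neg (by simp only; omega)]
    simp only
    omega

lemma bFn_ordConnected {n : ℕ} (i : Idx n) : (Set.range (bFn i)).OrdConnected := by
  constructor
  rintro _ ⟨x, rfl⟩ _ - y ⟨h1, -⟩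
  have h1' : (bFn i x).1 ≤ y.1 := h1
  rw [bFn_val] at h1'
  have hi := Set.mem_Ico.1 i.2
  have hy := Set.mem_Icc.1 y.2
  have hx := Set.mem_Icc.1 x.2
  by_cases h : y.1 ≤ i.1
  · have hy1 : 1 ≤ y.1 - 1 := by
      split_ifs at h1' <;> omega
    refine ⟨⟨y.1 - 1, Set.mem_Icc.2 ⟨hy1, by omega⟩⟩, Subtype.ext ?_⟩
    rw [bFn_val, if_pos (by simp only; omega)]
    simp only
    omega
  · refine ⟨y, Subtype.ext ?_⟩
    rw [bFn_val, if_neg h]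

lemma hFn_ordConnected {n : ℕ} : (Set.range (hFn (n := n))).OrdConnected := by
  have hs : Function.Surjective (hFn (n := n)) := by
    intro y
    have hy := Set.mem_Icc.1 y.2
    refine ⟨hFn y, Subtype.ext ?_⟩
    rw [hFn_val, hFn_val]
    omega
  rw [hs.range_eq]
  exact Set.ordConnected_univ

lemma aFn_mem {n : ℕ} (i : Idx n) : ofFn (aFn i) ∈ OrdInt n :=
  ⟨aFn_monotone i, aFn_ordConnected i⟩

lemma bFn_mem {n : ℕ} (i : Idx n) : ofFn (bFn i) ∈ OrdInt n :=
  ⟨bFn_monotone i, bFn_ordConnected i⟩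

lemma hFn_mem (n : ℕ) : ofFn (hFn (n := n)) ∈ MonInt n :=
  ⟨Or.inr hFn_antitone, hFn_ordConnected⟩

lemma ordInt_le_monInt (n : ℕ) : OrdInt n ≤ MonInt n := fun _ h => ⟨Or.inl h.1, h.2⟩

/-- The alphabet `A ∪ B = {a_1, …, a_{n-1}} ∪ {b_1, …, b_{n-1}}`. -/
inductive GenAB (n : ℕ) : Type
  | a (i : Idx n) : GenAB n
  | b (i : Idx n) : GenAB n

/-- The alphabet `C = A ∪ B ∪ {h}`. -/
inductive GenC (n : ℕ) : Type
  | ab (x : GenAB n) : GenC n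
  | h : GenC n

/-- The letters of `A ∪ B` as elements of `OrdInt n`. -/
def evalAB (n : ℕ) : GenAB n → OrdInt n
  | .a i => ⟨ofFn (aFn i), aFn_mem i⟩
  | .b i => ⟨ofFn (bFn i), bFn_mem i⟩

/-- The letters of `C` as elements of `MonInt n`. -/
def evalC (n : ℕ) : GenC n → MonInt n
  | .ab x => ⟨(evalAB n x).1, ordInt_le_monInt n (evalAB n x).2⟩
  | .h => ⟨ofFn hFn, hFn_mem n⟩

/-- A set of relations over the alphabet `α`: a set of pairs of words. -/
abbrev Rels (α : Type) : Type := Set (FreeMonoid α × FreeMonoid α)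

/-- The monoid `M` is defined by the presentation `⟨α ∣ R⟩` on the generators `g x`, `x : α`: the
quotient of the free monoid on `α` by the congruence generated by `R` is isomorphic to `M`, through
an isomorphism that sends the class of each letter `x` to `g x`. -/
def DefinedBy {α M : Type} [Monoid M] (g : α → M) (R : Rels α) : Prop :=
  ∃ e : PresentedMonoid (fun u v => (u, v) ∈ R) ≃* M,
    ∀ x : α, e (PresentedMonoid.of _ x) = g x

/-- The letter `a_i` as a word over `A ∪ B`. -/
abbrev wa {n : ℕ} (i : Idx n) : FreeMonoid (GenAB n) := FreeMonoid.of (GenAB.a i)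

/-- The letter `b_i` as a word over `A ∪ B`. -/
abbrev wb {n : ℕ} (i : Idx n) : FreeMonoid (GenAB n) := FreeMonoid.of (GenAB.b i)

/-- A set `R` of `(3n² - n - 2) / 2` relations over `A ∪ B`:
* `a_i a_j = a_{j+1} a_i` for `1 ≤ i ≤ j ≤ n - 2`, and `a_i a_{n-1} = a_i`;
* `b_i b_j = b_{j-1} b_i` for `2 ≤ j ≤ i ≤ n - 1`, and `b_i b_1 = b_i`;
* `a_i b_j = b_j a_i` for `1 ≤ j < i ≤ n - 1`;
* `a_i b_{n-1} = b_i` and `b_i a_1 = a_i`. -/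
def relsAB (n : ℕ) : Rels (GenAB n) :=
  {p | ∃ i j k : Idx n, i.1 ≤ j.1 ∧ k.1 = j.1 + 1 ∧ p = (wa i * wa j, wa k * wa i)} ∪
  {p | ∃ i j : Idx n, j.1 + 1 = n ∧ p = (wa i * wa j, wa i)} ∪
  {p | ∃ i j k : Idx n, j.1 ≤ i.1 ∧ k.1 + 1 = j.1 ∧ p = (wb i * wb j, wb k * wb i)} ∪
  {p | ∃ i j : Idx n, j.1 = 1 ∧ p = (wb i * wb j, wb i)} ∪
  {p | ∃ i j : Idx n, j.1 < i.1 ∧ p = (wa i * wb j, wb j * wa i)} ∪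
  {p | ∃ i j : Idx n, j.1 + 1 = n ∧ p = (wa i * wb j, wb i)} ∪
  {p | ∃ i j : Idx n, j.1 = 1 ∧ p = (wb i * wa j, wa i)}

/-- A word over `A ∪ B`, read as a word over `C`. -/
abbrev liftWord {n : ℕ} (w : FreeMonoid (GenAB n)) : FreeMonoid (GenC n) :=
  FreeMonoid.map GenC.ab w

/-- The letter `h` as a word over `C`. -/
abbrev wh (n : ℕ) : FreeMonoid (GenC n) := FreeMonoid.of GenC.h

/-- The relation `h² = 1`. -/
def N0 (n : ℕ) : Rels (GenC n) := {(wh n * wh n, 1)}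

/-- The relations `h a_i = b_{n-i} h`, for `1 ≤ i ≤ n - 1`. -/
def N1 (n : ℕ) : Rels (GenC n) :=
  {p | ∃ i j : Idx n, i.1 + j.1 = n ∧ p = (wh n * liftWord (wa i), liftWord (wb j) * wh n)}

/-- The relation `a_1^{n-1} h = b_{n-1}^{n-1}` (a single relation, for `n ≥ 2`). -/
def N2 (n : ℕ) : Rels (GenC n) :=
  {p | ∃ i j : Idx n, i.1 = 1 ∧ j.1 + 1 = n ∧
    p = (liftWord (wa i) ^ (n - 1) * wh n, liftWord (wb j) ^ (n - 1))}

/-- The set of relations `R ∪ N₀ ∪ N₁ ∪ N₂` over `C`, for a set `R` of relations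
over `A ∪ B`. -/
def relsBar {n : ℕ} (R : Rels (GenAB n)) : Rels (GenC n) :=
  Prod.map liftWord liftWord '' R ∪ N0 n ∪ N1 n ∪ N2 n

end IntervalMonoids

/-!
Over `A ∪ B` every word reduces to a normal form `w b_{n-1}^t`, where `w` is a product of letters
`a_i` with decreasing indices and `t` is at most the length of `w`. As a map, `w` identifies
neighbouring points of the chain and closes the gaps, the letters of `w` recording which neighbours
are identified, and `b_{n-1}^t` shifts the result to the right. So the map determines the normal
form, and every order-preserving map onto an interval arises in this way.

Every element of `IM_n` lies in `IO_n` or in `IO_n h`. The same dichotomy holds in the monoid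
presented over `C`, because `N₀` and `N₁` make conjugation by `h` preserve the words over `A ∪ B`.
The images of the two parts in `IM_n` meet only in constant maps, where `N₂` provides the missing
identification.
-/

namespace IntervalMonoids

section Presentations

variable {α M N : Type} [Monoid M] [Monoid N]

/-- The monoid presented by a set `R` of relations. -/
abbrev Presented (R : Rels α) : Type := PresentedMonoid fun u v => (u, v) ∈ R

/-- The elements `g x` satisfy the relations in `R` when substituted for the letters `x`. -/
def Satisfies (g : α → M) (R : Rels α) : Prop :=
  ∀ p ∈ R, FreeMonoid.lift g p.1 = FreeMonoid.lift g p.2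

lemma satisfies_union {g : α → M} {R R' : Rels α} :
    Satisfies g (R ∪ R') ↔ Satisfies g R ∧ Satisfies g R' := by
  simp only [Satisfies, Set.mem_union, or_imp, forall_and]

lemma satisfies_setOf_exists {g : α → M} {ι : Type} {P : ι → FreeMonoid α × FreeMonoid α → Prop} :
    Satisfies g {p | ∃ i, P i p} ↔ ∀ i, Satisfies g {p | P i p} :=
  ⟨fun h i p hp => h p ⟨i, hp⟩, fun h p ⟨i, hp⟩ => h i p hp⟩

lemma satisfies_setOf_and {g : α → M} {c : Prop} {P : FreeMonoid α × FreeMonoid α → Prop} :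
    Satisfies g {p | c ∧ P p} ↔ (c → Satisfies g {p | P p}) :=
  ⟨fun h hc p hp => h p ⟨hc, hp⟩, fun h p ⟨hc, hp⟩ => h hc p hp⟩

lemma satisfies_setOf_eq {g : α → M} {q : FreeMonoid α × FreeMonoid α} :
    Satisfies g {p | p = q} ↔ FreeMonoid.lift g q.1 = FreeMonoid.lift g q.2 :=
  forall_eq

lemma Satisfies.comp {g : α → M} {R : Rels α} (h : Satisfies g R) (φ : M →* N) :
    Satisfies (φ ∘ g) R := fun p hp => by
  simpa only [FreeMonoid.hom_map_lift] using congrArg φ (h p hp)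

lemma satisfies_of (R : Rels α) :
    Satisfies (fun x => (PresentedMonoid.of _ x : Presented R)) R := fun p hp => by
  have lift_of : FreeMonoid.lift (fun x => (PresentedMonoid.of _ x : Presented R)) =
      PresentedMonoid.mk _ := FreeMonoid.hom_eq fun _ => rfl
  rw [lift_of]
  exact PresentedMonoid.mk_eq_mk_of_rel hp

/-- The homomorphism from the presented monoid given by elements that satisfy the relations. -/
def Satisfies.lift {g : α → M} {R : Rels α} (h : Satisfies g R) : Presented R →* M :=
  PresentedMonoid.lift g fun u v huv => h (u, v) huv

@[simp]
lemma Satisfies.lift_of {g : α → M} {R : Rels α} (h : Satisfies g R) (x : α) :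
    h.lift (PresentedMonoid.of _ x) = g x := rfl

lemma Satisfies.definedBy {g : α → M} {R : Rels α} (h : Satisfies g R)
    (hbij : Function.Bijective h.lift) : DefinedBy g R :=
  ⟨MulEquiv.ofBijective _ hbij, fun _ => rfl⟩

lemma DefinedBy.satisfies {g : α → M} {R : Rels α} (h : DefinedBy g R) : Satisfies g R := by
  obtain ⟨e, he⟩ := h
  rw [← show _ = g from funext he]
  exact (satisfies_of R).comp e.toMonoidHom

lemma DefinedBy.exists_hom {g : α → M} {R : Rels α} (h : DefinedBy g R) {f : α → N}
    (hf : Satisfies f R) : ∃ φ : M →* N, ∀ x, φ (g x) = f x := by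
  obtain ⟨e, he⟩ := h
  exact ⟨hf.lift.comp e.symm.toMonoidHom, fun x => by simp [← he]⟩

lemma DefinedBy.closure_range {g : α → M} {R : Rels α} (h : DefinedBy g R) :
    Submonoid.closure (Set.range g) = ⊤ := by
  obtain ⟨e, he⟩ := h
  have map_top : (⊤ : Submonoid (Presented R)).map e.toMonoidHom = ⊤ :=
    Submonoid.map_equiv_top e
  rw [← show _ = g from funext he, ← map_top, ← PresentedMonoid.closure_range_of,
    MonoidHom.map_mclosure, ← Set.range_comp]
  rfl

end Presentations

section Relations

variable {n : ℕ} {M : Type} [Monoid M]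

lemma satisfies_relsAB_iff {f : GenAB n → M} : Satisfies f (relsAB n) ↔
    (∀ i j k : Idx n, i.1 ≤ j.1 → k.1 = j.1 + 1 → f (.a i) * f (.a j) = f (.a k) * f (.a i)) ∧
    (∀ i j : Idx n, j.1 + 1 = n → f (.a i) * f (.a j) = f (.a i)) ∧
    (∀ i j k : Idx n, j.1 ≤ i.1 → k.1 + 1 = j.1 → f (.b i) * f (.b j) = f (.b k) * f (.b i)) ∧
    (∀ i j : Idx n, j.1 = 1 → f (.b i) * f (.b j) = f (.b i)) ∧
    (∀ i j : Idx n, j.1 < i.1 → f (.a i) * f (.b j) = f (.b j) * f (.a i)) ∧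
    (∀ i j : Idx n, j.1 + 1 = n → f (.a i) * f (.b j) = f (.b i)) ∧
    (∀ i j : Idx n, j.1 = 1 → f (.b i) * f (.a j) = f (.a i)) := by
  simp only [relsAB, satisfies_union, satisfies_setOf_exists, satisfies_setOf_and,
    satisfies_setOf_eq, map_mul, FreeMonoid.lift_eval_of, and_assoc]

lemma satisfies_relsBar_iff {f : GenC n → M} {R : Rels (GenAB n)} : Satisfies f (relsBar R) ↔
    Satisfies (f ∘ GenC.ab) R ∧ f .h * f .h = 1 ∧
    (∀ i j : Idx n, i.1 + j.1 = n → f .h * f (.ab (.a i)) = f (.ab (.b j)) * f .h) ∧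
    (∀ i j : Idx n, i.1 = 1 → j.1 + 1 = n →
      f (.ab (.a i)) ^ (n - 1) * f .h = f (.ab (.b j)) ^ (n - 1)) := by
  have lift_liftWord (w : FreeMonoid (GenAB n)) :
      FreeMonoid.lift f (liftWord w) = FreeMonoid.lift (f ∘ GenC.ab) w := by
    rw [liftWord, ← FreeMonoid.lift_of_comp_eq_map, FreeMonoid.hom_map_lift]
    rfl
  simp only [relsBar, satisfies_union, and_assoc]
  refine and_congr ?_ <| and_congr ?_ <| and_congr ?_ ?_
  · simp only [Satisfies, Set.forall_mem_image, Prod.map_fst, Prod.map_snd, lift_liftWord]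
  · simp only [N0, Satisfies, Set.mem_singleton_iff, forall_eq, map_mul, map_one,
      FreeMonoid.lift_eval_of]
  · simp only [N1, satisfies_setOf_exists, satisfies_setOf_and, satisfies_setOf_eq, map_mul,
      lift_liftWord, FreeMonoid.lift_eval_of, Function.comp_apply]
  · simp only [N2, satisfies_setOf_exists, satisfies_setOf_and, satisfies_setOf_eq, map_mul,
      map_pow, lift_liftWord, FreeMonoid.lift_eval_of, Function.comp_apply]

end Relations

section Transformations

variable {n : ℕ}

lemma eq_of_toFn_eq {P : Submonoid (Transf n)} {u v : P} (h : toFn u.1 = toFn v.1) : u = v :=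
  Subtype.ext (MulOpposite.unop_injective h)

lemma toFn_mul_apply (f g : Transf n) (x : Chain n) : toFn (f * g) x = toFn g (toFn f x) := rfl

lemma hFn_hFn (x : Chain n) : hFn (hFn x) = x := by
  have hx := Set.mem_Icc.1 x.2
  refine Subtype.ext ?_
  rw [hFn_val, hFn_val]
  omega

lemma hFn_aFn {i j : Idx n} (hij : i.1 + j.1 = n) (x : Chain n) :
    aFn i (hFn x) = hFn (bFn j x) := by
  have hx := Set.mem_Icc.1 x.2
  refine Subtype.ext ?_
  rw [aFn_val, hFn_val, hFn_val, bFn_val]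
  split_ifs <;> omega

lemma aFn_iterate_val {i : Idx n} (hi : i.1 = 1) (k : ℕ) (x : Chain n) :
    ((aFn i)^[k] x).1 = max 1 (x.1 - k) := by
  induction k with
  | zero => exact (max_eq_right x.2.1).symm
  | succ k ih =>
    rw [Function.iterate_succ_apply', aFn_val, ih]
    split_ifs <;> omega

lemma bFn_iterate_val {j : Idx n} (hj : j.1 + 1 = n) (k : ℕ) (x : Chain n) :
    ((bFn j)^[k] x).1 = min n (x.1 + k) := by
  induction k with
  | zero => exact (min_eq_right x.2.2).symm
  | succ k ih =>
    rw [Function.iterate_succ_apply', bFn_val, ih]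
    split_ifs <;> omega

end Transformations

section CollapseWord

variable {M : Type} [Monoid M]

/-- The product of the elements `α k`, in decreasing order of `k`, over the positions `k` at which
the pattern `l` holds `true`. Positions count from the end of the list, so the head of `k + 1`
entries stands at position `k`. -/
def collapseWord (α : ℕ → M) : List Bool → M
  | [] => 1
  | e :: l => (if e then α l.length else 1) * collapseWord α l

lemma map_collapseWord {N : Type} [Monoid N] (φ : M →* N) (α : ℕ → M) (l : List Bool) :
    φ (collapseWord α l) = collapseWord (φ ∘ α) l := by
  induction l with
  | nil => exact map_one φ
  | cons e l ih => cases e <;> simp [collapseWord, ih]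

lemma collapseWord_replicate_false (α : ℕ → M) (k : ℕ) :
    collapseWord α (List.replicate k false) = 1 := by
  induction k with
  | zero => rfl
  | succ k ih => simp [collapseWord, List.replicate_succ, ih]

/-- The relations used to rewrite products of `α 0, …, α m, β` into the form `w βᵗ`, with `w` a
collapse word. In `IO_n`, for `n = m + 2`, they hold for `α k = a_{k+1}` and `β = b_{n-1}`; setting
`α (m + 1) = 1` makes `α i * α m = α i` an instance of the first relation. -/
structure IsCollapseSystem (m : ℕ) (α : ℕ → M) (β : M) : Prop where
  mul_of_le : ∀ ⦃i j⦄, i ≤ j → j ≤ m → α i * α j = α (j + 1) * α i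
  top_eq_one : α (m + 1) = 1
  shift_mul_zero : β * α 0 = α m
  shift_mul_succ : ∀ ⦃i⦄, i < m → β * α (i + 1) = α m * α i * β
  mul_shift : α m * β = β

namespace IsCollapseSystem

variable {m : ℕ} {α : ℕ → M} {β : M}

lemma mul_last (h : IsCollapseSystem m α β) {i : ℕ} (hi : i ≤ m) : α i * α m = α i := by
  rw [h.mul_of_le hi le_rfl, h.top_eq_one, one_mul]

lemma exists_mul_collapseWord_eq (h : IsCollapseSystem m α β) {j : ℕ} {l : List Bool}
    (hj : j ≤ l.length) (hl : l.length ≤ m + 1) :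
    ∃ l' : List Bool, l'.length = l.length + 1 ∧ l'.count true = l.count true + 1 ∧
      α j * collapseWord α l = collapseWord α l' := by
  induction l with
  | nil => exact ⟨[true], rfl, rfl, by rw [Nat.le_zero.1 hj]; rfl⟩
  | cons e l ih =>
    rcases hj.eq_or_lt with rfl | hj
    · exact ⟨true :: e :: l, rfl, List.count_cons_self, rfl⟩
    have hjl : j ≤ l.length := Nat.lt_succ_iff.1 hj
    have hlm : l.length ≤ m := Nat.succ_le_succ_iff.1 hl
    obtain ⟨l', hlen, hcount, heq⟩ := ih hjl (by omega)
    refine ⟨e :: l', by simp [hlen], by grind, ?_⟩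
    cases e with
    | false => simpa [collapseWord] using heq
    | true =>
      calc α j * (α l.length * collapseWord α l)
        _ = α (l.length + 1) * (α j * collapseWord α l) := by
          rw [← mul_assoc, h.mul_of_le hjl hlm, mul_assoc]
        _ = α l'.length * collapseWord α l' := by rw [heq, hlen]

lemma exists_mul_collapseWord_eq_of_length (h : IsCollapseSystem m α β) {j : ℕ} {l : List Bool}
    (hj : j ≤ m) (hl : l.length = m + 1) :
    ∃ l' : List Bool, l'.length = m + 1 ∧ l.count true ≤ l'.count true ∧
      α j * collapseWord α l = collapseWord α l' := by
  obtain ⟨_ | ⟨e, l'⟩, hlen, hcount, heq⟩ :=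
    h.exists_mul_collapseWord_eq (j := j) (l := l) (by omega) hl.le
  · simp at hlen
  have hl' : l'.length = m + 1 := by simpa [hl] using hlen
  refine ⟨l', hl', ?_, ?_⟩
  · grind
  · simp [heq, collapseWord, hl', h.top_eq_one]

lemma shift_mul_collapseWord (h : IsCollapseSystem m α β) {l : List Bool} (hl : l.length ≤ m)
    (e : Bool) : β * collapseWord α (l ++ [e]) =
      α m * collapseWord α l * (if e then 1 else β) := by
  induction l with
  | nil => cases e <;> simp [collapseWord, h.shift_mul_zero, h.mul_shift]
  | cons d l ih =>
    have hl' : l.length < m := hl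
    cases d with
    | false => simpa [collapseWord] using ih hl'.le
    | true =>
      calc β * (α (l ++ [e]).length * collapseWord α (l ++ [e]))
        _ = α m * α l.length * (β * collapseWord α (l ++ [e])) := by
          rw [← mul_assoc, List.length_append, List.length_singleton, h.shift_mul_succ hl',
            mul_assoc]
        _ = α m * (α l.length * α m) * collapseWord α l * (if e then 1 else β) := by
          simp only [ih hl'.le, mul_assoc]
        _ = _ := by rw [h.mul_last hl'.le, collapseWord, if_pos rfl, mul_assoc (α m)]

lemma exists_normalForm (h : IsCollapseSystem m α β) {x : M}
    (hx : x ∈ Submonoid.closure (α '' Set.Iic m ∪ {β})) :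
    ∃ (l : List Bool) (t : ℕ), l.length = m + 1 ∧ t ≤ l.count true ∧
      x = collapseWord α l * β ^ t := by
  induction hx using Submonoid.closure_induction_left with
  | one =>
    exact ⟨List.replicate (m + 1) false, 0, List.length_replicate, Nat.zero_le _, by
      rw [collapseWord_replicate_false, pow_zero, mul_one]⟩
  | mul_left y hy x _ ih =>
    obtain ⟨l, t, hl, ht, rfl⟩ := ih
    rcases hy with ⟨j, hj, rfl⟩ | rfl
    · obtain ⟨l', hl', hcount, heq⟩ := h.exists_mul_collapseWord_eq_of_length hj hl
      exact ⟨l', t, hl', ht.trans hcount, by rw [← mul_assoc, heq]⟩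
    · obtain ⟨l, e, rfl⟩ := List.eq_nil_or_concat' l |>.resolve_left (by grind)
      have hlm : l.length = m := by simpa using hl
      have mul_eq : y * collapseWord α (l ++ [e]) =
          collapseWord α (true :: l) * (if e then 1 else y) := by
        rw [h.shift_mul_collapseWord hlm.le, collapseWord, if_pos rfl, hlm]
      refine ⟨true :: l, if e then t else t + 1, by simp [hlm], by grind, ?_⟩
      rw [← mul_assoc, mul_eq, mul_assoc]
      cases e
      · simp [pow_succ']
      · simp

end IsCollapseSystem

end CollapseWord

section Letters

variable {m : ℕ} {M : Type} [Monoid M]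

/-- The element `f a_{k+1}` if `a_{k+1}` is a letter, and `1` otherwise. -/
def letterA (f : GenAB (m + 2) → M) (k : ℕ) : M :=
  if hk : k ≤ m then f (.a ⟨k + 1, by grind⟩) else 1

/-- The element `f b_{n-1}`, for `n = m + 2`. -/
abbrev lastB (f : GenAB (m + 2) → M) : M := f (.b ⟨m + 1, by grind⟩)

lemma letterA_of_le (f : GenAB (m + 2) → M) {k : ℕ} (hk : k ≤ m) :
    letterA f k = f (.a ⟨k + 1, by grind⟩) := dif_pos hk

lemma map_comp_letterA {N : Type} [Monoid N] (φ : M →* N) (f : GenAB (m + 2) → M) :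
    φ ∘ letterA f = letterA (φ ∘ f) := by
  funext k
  simp only [Function.comp_apply, letterA]
  split_ifs
  · rfl
  · exact map_one φ

lemma Satisfies.isCollapseSystem {f : GenAB (m + 2) → M} (hf : Satisfies f (relsAB (m + 2))) :
    IsCollapseSystem m (letterA f) (lastB f) := by
  obtain ⟨aa, aa_top, bb, -, ab, ab_top, ba_one⟩ := satisfies_relsAB_iff.1 hf
  have top_eq_one : letterA f (m + 1) = 1 := dif_neg (by omega)
  refine ⟨fun i j hij hj => ?_, top_eq_one, ?_, fun i hi => ?_, ?_⟩
  · rcases hj.eq_or_lt with rfl | hj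
    · rw [top_eq_one, one_mul, letterA_of_le f hij, letterA_of_le f le_rfl, aa_top _ _ rfl]
    · rw [letterA_of_le f (hij.trans hj.le), letterA_of_le f hj.le, letterA_of_le f hj]
      exact aa _ _ _ (Nat.succ_le_succ hij) rfl
  · rw [letterA_of_le f (Nat.zero_le m), letterA_of_le f le_rfl, ba_one _ _ rfl]
  · let one : Idx (m + 2) := ⟨1, by grind⟩
    let last : Idx (m + 2) := ⟨m + 1, by grind⟩
    let k : Idx (m + 2) := ⟨i + 1, by grind⟩
    let l : Idx (m + 2) := ⟨i + 2, by grind⟩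
    rw [letterA_of_le f hi, letterA_of_le f le_rfl, letterA_of_le f hi.le]
    calc f (.b last) * f (.a l)
      _ = f (.b last) * f (.b l) * f (.a one) := by rw [mul_assoc, ba_one l one rfl]
      _ = f (.b k) * f (.b last) * f (.a one) := by rw [bb last l k (by grind) rfl]
      _ = f (.b k) * f (.a last) := by rw [mul_assoc, ba_one last one rfl]
      _ = f (.a last) * f (.b k) := (ab last k (by grind)).symm
      _ = f (.a last) * f (.a k) * f (.b last) := by rw [mul_assoc, ab_top k last rfl]
  · rw [letterA_of_le f le_rfl, ab_top _ _ rfl]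

lemma Satisfies.mem_closure_letters {f : GenAB (m + 2) → M} (hf : Satisfies f (relsAB (m + 2)))
    {x : M} (hx : x ∈ Submonoid.closure (Set.range f)) :
    x ∈ Submonoid.closure (letterA f '' Set.Iic m ∪ {lastB f}) := by
  obtain ⟨-, -, -, -, -, ab_top, -⟩ := satisfies_relsAB_iff.1 hf
  have a_mem (i : Idx (m + 2)) :
      f (.a i) ∈ Submonoid.closure (letterA f '' Set.Iic m ∪ {lastB f}) := by
    obtain ⟨_ | k, hi⟩ := i
    · simp at hi
    have hk : k ≤ m := by grind
    exact Submonoid.subset_closure (Or.inl ⟨k, hk, letterA_of_le f hk⟩)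
  refine Submonoid.closure_le.2 ?_ hx
  rintro _ ⟨i | i, rfl⟩
  · exact a_mem i
  · rw [← ab_top i ⟨m + 1, by grind⟩ rfl]
    exact mul_mem (a_mem i) (Submonoid.subset_closure (Or.inr rfl))

end Letters

section Collapse

/-- The map induced on `{0, 1, 2, …}` by a collapse word: for each `true` of the pattern, from the
head on, identify `k` with `k + 1` and close the gap, where `k` is the position of the entry. -/
def collapse : List Bool → ℕ → ℕ
  | [], p => p
  | e :: l, p => collapse l (if e ∧ l.length < p then p - 1 else p)

lemma collapse_cons_of_le {e : Bool} {l : List Bool} {p : ℕ} (hp : p ≤ l.length) :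
    collapse (e :: l) p = collapse l p := by
  rw [collapse, if_neg (by omega)]

lemma collapse_add_count {l : List Bool} {p : ℕ} (hp : l.length ≤ p) :
    collapse l p + l.count true = p := by
  induction l generalizing p with
  | nil => rfl
  | cons e l ih =>
    have hp : l.length + 1 ≤ p := hp
    cases e with
    | false => simpa [collapse] using ih (by omega)
    | true =>
      have := ih (p := p - 1) (by omega)
      rw [collapse, if_pos ⟨rfl, by omega⟩, List.count_cons_self]
      omega

lemma collapse_add_count_le {l : List Bool} {p : ℕ} (hp : p ≤ l.length) :
    collapse l p + l.count true ≤ l.length := by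
  induction l with
  | nil => exact hp
  | cons e l ih =>
    rcases hp.eq_or_lt with rfl | hp
    · exact (collapse_add_count le_rfl).le
    have hp : p ≤ l.length := Nat.lt_succ_iff.1 hp
    have count_cons_le : (e :: l).count true ≤ l.count true + 1 := by
      rw [List.count_cons]
      split_ifs <;> omega
    rw [collapse_cons_of_le hp, List.length_cons]
    have := ih hp
    omega

lemma collapse_cons_length_succ (e : Bool) (l : List Bool) :
    collapse (e :: l) (l.length + 1) = collapse l l.length + if e then 0 else 1 := by
  cases e with
  | true => simp [collapse]
  | false =>
    have at_length := collapse_add_count (le_refl l.length)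
    have at_succ := collapse_add_count (Nat.le_add_right l.length 1)
    simp only [collapse, Bool.false_eq_true, false_and, if_false]
    omega

lemma eq_of_collapse_add_eq {l l' : List Bool} {t t' : ℕ} (hlen : l.length = l'.length)
    (h : ∀ p ≤ l.length, collapse l p + t = collapse l' p + t') : l = l' ∧ t = t' := by
  induction l generalizing l' with
  | nil =>
    obtain rfl := List.length_eq_zero_iff.1 hlen.symm
    simpa [collapse] using h 0 le_rfl
  | cons e l ih =>
    obtain _ | ⟨e', l'⟩ := l'
    · simp at hlen
    have hlen : l.length = l'.length := Nat.succ.inj hlen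
    obtain ⟨rfl, rfl⟩ := ih hlen fun p hp => by
      simpa only [collapse_cons_of_le hp, collapse_cons_of_le (hlen ▸ hp)] using
        h p (Nat.le_succ_of_le hp)
    have at_succ := h (l.length + 1) le_rfl
    rw [collapse_cons_length_succ, collapse_cons_length_succ] at at_succ
    cases e <;> cases e' <;> simp at at_succ ⊢

lemma exists_collapse_add_eq {f : ℕ → ℕ} {k : ℕ}
    (hf : ∀ p < k, f (p + 1) = f p ∨ f (p + 1) = f p + 1) :
    ∃ l : List Bool, l.length = k ∧ ∀ p ≤ k, f p = collapse l p + f 0 := by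
  induction k with
  | zero => exact ⟨[], rfl, fun p hp => by simp [collapse, Nat.le_zero.1 hp]⟩
  | succ k ih =>
    obtain ⟨l, rfl, hl⟩ := ih fun p hp => hf p (by omega)
    refine ⟨decide (f (l.length + 1) = f l.length) :: l, rfl, fun p hp => ?_⟩
    rcases hp.eq_or_lt with rfl | hp
    · rw [collapse_cons_length_succ, add_right_comm, ← hl _ le_rfl]
      rcases hf _ l.length.lt_succ_self with h | h <;> simp [h]
    · have hp : p ≤ l.length := Nat.lt_succ_iff.1 hp
      rw [collapse_cons_of_le hp, hl p hp]

end Collapse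

section OrdInt

variable {m : ℕ}

lemma wcovBy_of_monotone_of_ordConnected_range {X Y : Type} [LinearOrder X] [LinearOrder Y]
    {f : X → Y} (hf : Monotone f) (hrange : (Set.range f).OrdConnected) {x y : X} (hxy : x ⩿ y) :
    f x ⩿ f y := by
  refine ⟨hf hxy.le, fun c hxc hcy => ?_⟩
  obtain ⟨z, rfl⟩ := hrange.out ⟨x, rfl⟩ ⟨y, rfl⟩ ⟨hxc.le, hcy.le⟩
  exact hxy.2 (hf.reflect_lt hxc) (hf.reflect_lt hcy)

lemma val_wcovBy_val {n : ℕ} {x y : Chain n} : x.1 ⩿ y.1 ↔ x ⩿ y :=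
  Set.OrdConnected.apply_wcovBy_apply_iff (OrderEmbedding.subtype (· ∈ Set.Icc 1 n)) <|
    show (Set.range Subtype.val).OrdConnected from Subtype.range_val ▸ Set.ordConnected_Icc

lemma apply_succ_eq_or {n : ℕ} {f : Chain n → Chain n} (hf : Monotone f)
    (hrange : (Set.range f).OrdConnected) {x y : Chain n} (hxy : x.1 + 1 = y.1) :
    (f y).1 = (f x).1 ∨ (f y).1 = (f x).1 + 1 := by
  have hcov : x ⩿ y := val_wcovBy_val.1 (Nat.covBy_iff_add_one_eq.2 hxy).wcovBy
  have hcov_apply := val_wcovBy_val.2 (wcovBy_of_monotone_of_ordConnected_range hf hrange hcov)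
  rw [wcovBy_iff_covBy_or_eq, Nat.covBy_iff_add_one_eq] at hcov_apply
  omega

lemma satisfies_evalAB (n : ℕ) : Satisfies (evalAB n) (relsAB n) := by
  have a_apply (i : Idx n) : toFn (evalAB n (.a i)).1 = aFn i := rfl
  have b_apply (i : Idx n) : toFn (evalAB n (.b i)).1 = bFn i := rfl
  refine satisfies_relsAB_iff.2 ⟨?_, ?_, ?_, ?_, ?_, ?_, ?_⟩ <;> intros <;>
    refine eq_of_toFn_eq (funext fun x => Subtype.ext ?_) <;>
    simp only [Submonoid.coe_mul, toFn_mul_apply, a_apply, b_apply, aFn_val, bFn_val] <;> grind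

lemma toFn_letterA_val (k : ℕ) (x : Chain (m + 2)) :
    (toFn (letterA (evalAB (m + 2)) k).1 x).1 =
      (if k < x.1 - 1 then x.1 - 1 - 1 else x.1 - 1) + 1 := by
  have hx := Set.mem_Icc.1 x.2
  by_cases hk : k ≤ m
  · rw [letterA_of_le _ hk]
    change (aFn _ x).1 = _
    rw [aFn_val]
    grind
  · rw [letterA, dif_neg hk]
    change x.1 = _
    grind

lemma toFn_collapseWord_val (l : List Bool) (x : Chain (m + 2)) :
    (toFn (collapseWord (letterA (evalAB (m + 2))) l).1 x).1 = collapse l (x.1 - 1) + 1 := by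
  induction l generalizing x with
  | nil => exact (Nat.sub_add_cancel x.2.1).symm
  | cons e l ih =>
    rw [collapseWord, Submonoid.coe_mul, toFn_mul_apply, ih, collapse]
    cases e with
    | false => simp only [Bool.false_eq_true, false_and, if_false]; rfl
    | true => simp [toFn_letterA_val]

lemma toFn_normalForm_val (l : List Bool) (t : ℕ) (x : Chain (m + 2)) :
    (toFn (collapseWord (letterA (evalAB (m + 2))) l * lastB (evalAB (m + 2)) ^ t).1 x).1 =
      min (m + 2) (collapse l (x.1 - 1) + 1 + t) := by
  rw [← toFn_collapseWord_val]
  exact bFn_iterate_val rfl t _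

lemma normalForm_injective {l l' : List Bool} {t t' : ℕ} (hl : l.length = m + 1)
    (hl' : l'.length = m + 1) (ht : t ≤ l.count true) (ht' : t' ≤ l'.count true)
    (h : collapseWord (letterA (evalAB (m + 2))) l * lastB (evalAB (m + 2)) ^ t =
      collapseWord (letterA (evalAB (m + 2))) l' * lastB (evalAB (m + 2)) ^ t') :
    l = l' ∧ t = t' := by
  refine eq_of_collapse_add_eq (hl.trans hl'.symm) fun p hp => ?_
  have h_apply := congrArg (fun u => (toFn u.1 ⟨p + 1, by grind⟩).1) h
  simp only [toFn_normalForm_val, Nat.add_sub_cancel] at h_apply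
  have := collapse_add_count_le hp
  have := collapse_add_count_le (hl'.symm ▸ hl ▸ hp : p ≤ l'.length)
  omega

lemma exists_eq_normalForm (f : OrdInt (m + 2)) : ∃ (l : List Bool) (t : ℕ),
    f = collapseWord (letterA (evalAB (m + 2))) l * lastB (evalAB (m + 2)) ^ t := by
  obtain ⟨f, hf, hrange⟩ := f
  let proj := Set.projIcc 1 (m + 2) (by omega)
  have proj_val {p : ℕ} (hp : p ≤ m + 1) : (proj (p + 1)).1 = p + 1 :=
    congrArg Subtype.val (Set.projIcc_of_mem _ ⟨by omega, by omega⟩)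
  obtain ⟨l, -, hl⟩ := exists_collapse_add_eq (f := fun p => (toFn f (proj (p + 1))).1)
    (k := m + 1) fun p hp => apply_succ_eq_or hf hrange (by
      rw [proj_val hp.le, proj_val (p := p + 1) hp])
  refine ⟨l, (toFn f (proj 1)).1 - 1, eq_of_toFn_eq (funext fun x => Subtype.ext ?_)⟩
  have hx := Set.mem_Icc.1 x.2
  have proj_x : proj (x.1 - 1 + 1) = x := Subtype.ext <| by rw [proj_val (by omega)]; omega
  have fx_eq : (toFn f x).1 = collapse l (x.1 - 1) + (toFn f (proj 1)).1 := by
    simpa only [proj_x] using hl (x.1 - 1) (by omega)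
  have fx_le := Set.mem_Icc.1 (toFn f x).2
  have f_one_le := Set.mem_Icc.1 (toFn f (proj 1)).2
  rw [toFn_normalForm_val, fx_eq]
  omega

lemma definedBy_relsAB {n : ℕ} (hn : 2 ≤ n) : DefinedBy (evalAB n) (relsAB n) := by
  obtain ⟨m, rfl⟩ := Nat.exists_eq_add_of_le' hn
  let φ := (satisfies_evalAB (m + 2)).lift
  have hf := satisfies_of (relsAB (m + 2))
  have map_normalForm (l : List Bool) (t : ℕ) :
      φ (collapseWord (letterA (PresentedMonoid.of _)) l * lastB (PresentedMonoid.of _) ^ t) =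
        collapseWord (letterA (evalAB (m + 2))) l * lastB (evalAB (m + 2)) ^ t := by
    rw [map_mul, map_pow, map_collapseWord, map_comp_letterA]
    rfl
  have exists_normalForm (s : Presented (relsAB (m + 2))) :=
    hf.isCollapseSystem.exists_normalForm (hf.mem_closure_letters
      (PresentedMonoid.closure_range_of _ ▸ Submonoid.mem_top s))
  refine (satisfies_evalAB (m + 2)).definedBy ⟨fun x y hxy => ?_, fun f => ?_⟩
  · obtain ⟨l, t, hl, ht, rfl⟩ := exists_normalForm x
    obtain ⟨l', t', hl', ht', rfl⟩ := exists_normalForm y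
    obtain ⟨rfl, rfl⟩ := normalForm_injective hl hl' ht ht'
      ((map_normalForm l t).symm.trans (hxy.trans (map_normalForm l' t')))
    rfl
  · obtain ⟨l, t, rfl⟩ := exists_eq_normalForm f
    exact ⟨_, map_normalForm l t⟩

end OrdInt

section Involution

variable {S T : Type} [Monoid S] [Monoid T] {h : S} {N : Submonoid S}

lemma mul_mul_cancel_left_of_mul_self (hh : h * h = 1) (x : S) : h * (h * x) = x := by
  rw [← mul_assoc, hh, one_mul]

lemma mul_mul_cancel_right_of_mul_self (hh : h * h = 1) (x : S) : x * h * h = x := by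
  rw [mul_assoc, hh, mul_one]

lemma conj_mem_closure (hh : h * h = 1) {s : Set S}
    (hs : ∀ x ∈ s, h * x * h ∈ Submonoid.closure s) {x : S} (hx : x ∈ Submonoid.closure s) :
    h * x * h ∈ Submonoid.closure s := by
  induction hx using Submonoid.closure_induction with
  | mem x hx => exact hs x hx
  | one => simp [hh]
  | mul x y _ _ ihx ihy =>
    have conj_mul : h * (x * y) * h = h * x * h * (h * y * h) := by
      simp only [mul_assoc, mul_mul_cancel_left_of_mul_self hh]
    exact conj_mul ▸ mul_mem ihx ihy

lemma mem_or_mul_mem (hh : h * h = 1) (hN : ∀ x ∈ N, h * x * h ∈ N) {x : S}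
    (hx : x ∈ Submonoid.closure (N ∪ {h})) : x ∈ N ∨ x * h ∈ N := by
  induction hx using Submonoid.closure_induction_right with
  | one => exact Or.inl (one_mem N)
  | mul_right x _ y hy ih =>
    rcases hy with hy | rfl
    · refine ih.imp (mul_mem · hy) fun hx => ?_
      have mul_mul : x * y * h = x * h * (h * y * h) := by
        simp only [mul_assoc, mul_mul_cancel_left_of_mul_self hh]
      exact mul_mul ▸ mul_mem hx (hN y hy)
    · refine ih.symm.imp id fun hx => ?_
      rwa [mul_mul_cancel_right_of_mul_self hh]

lemma injective_of_injOn (hh : h * h = 1) (hmem : ∀ x, x ∈ N ∨ x * h ∈ N) {φ : S →* T}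
    (hinj : Set.InjOn φ N) (hcross : ∀ x ∈ N, ∀ y ∈ N, φ x = φ (y * h) → y * h ∈ N) :
    Function.Injective φ := by
  have mul_mul_cancel := mul_mul_cancel_right_of_mul_self hh
  have mem_of_eq {x y : S} (hx : x ∈ N) (hxy : φ x = φ y) : y ∈ N :=
    (hmem y).elim id fun hy => mul_mul_cancel y ▸
      hcross x hx _ hy (by rwa [mul_mul_cancel])
  intro x y hxy
  rcases hmem x with hx | hx
  · exact hinj hx (mem_of_eq hx hxy) hxy
  · have hxy' : φ (x * h) = φ (y * h) := by rw [map_mul, map_mul, hxy]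
    rw [← mul_mul_cancel x, hinj hx (mem_of_eq hx hxy') hxy', mul_mul_cancel]

end Involution

section MonInt

variable {n : ℕ}

/-- The inclusion of `IO_n` in `IM_n`. -/
abbrev toMonInt (n : ℕ) : OrdInt n →* MonInt n := Submonoid.inclusion (ordInt_le_monInt n)

lemma Satisfies.evalC_relsBar {R : Rels (GenAB n)} (hR : Satisfies (evalAB n) R) :
    Satisfies (evalC n) (relsBar R) := by
  refine satisfies_relsBar_iff.2 ⟨hR.comp (toMonInt n), ?_, fun i j hij => ?_,
    fun i j hi hj => ?_⟩ <;> refine eq_of_toFn_eq ?_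
  · exact funext hFn_hFn
  · exact funext (hFn_aFn hij)
  · refine funext fun x => Subtype.ext ?_
    have hx := Set.mem_Icc.1 x.2
    change (hFn ((aFn i)^[n - 1] x)).1 = ((bFn j)^[n - 1] x).1
    rw [hFn_val, aFn_iterate_val hi, bFn_iterate_val hj]
    omega

lemma monInt_eq_or (f : MonInt n) :
    ∃ g : OrdInt n, f = toMonInt n g ∨ f = toMonInt n g * evalC n .h := by
  rcases f with ⟨f, hf | hf, hrange⟩
  · exact ⟨⟨f, hf, hrange⟩, Or.inl rfl⟩
  · refine ⟨⟨ofFn (hFn ∘ toFn f), hFn_antitone.comp hf,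
      ordConnected_range_comp (f := toFn f) hrange hFn_ordConnected (Or.inr hFn_antitone)⟩,
      Or.inr ?_⟩
    exact eq_of_toFn_eq (funext fun x => (hFn_hFn _).symm)

lemma mul_eq_self_of_toMonInt_eq_mul {u v : OrdInt n}
    (huv : toMonInt n u = toMonInt n v * evalC n .h) (w : OrdInt n) : w * v = v := by
  have hv : toFn v.1 = hFn ∘ toFn u.1 := by
    funext z
    rw [show u.1 = v.1 * ofFn hFn from congrArg Subtype.val huv]
    exact (hFn_hFn _).symm
  exact eq_of_toFn_eq <| funext fun z =>
    constant_of_monotone_antitone v.2.1 (hv ▸ hFn_antitone.comp_monotone u.2.1) _ _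

end MonInt

section DefinedByRelsBar

variable {n : ℕ} {R : Rels (GenAB n)} {S : Type} [Monoid S] {f : GenC n → S}
  {ι : OrdInt n →* S}

lemma conj_mem_mrange (hR : DefinedBy (evalAB n) R) (hf : Satisfies f (relsBar R))
    (hι : ∀ x, ι (evalAB n x) = f (.ab x)) {s : S} (hs : s ∈ MonoidHom.mrange ι) :
    f .h * s * f .h ∈ MonoidHom.mrange ι := by
  obtain ⟨-, hh, ha, -⟩ := satisfies_relsBar_iff.1 hf
  have mrange_eq : MonoidHom.mrange ι = Submonoid.closure (Set.range (f ∘ GenC.ab)) := by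
    rw [MonoidHom.mrange_eq_map, ← hR.closure_range, MonoidHom.map_mclosure, ← Set.range_comp]
    exact congrArg (fun g => Submonoid.closure (Set.range g)) (funext hι)
  have exists_refl (i : Idx n) : ∃ j : Idx n, i.1 + j.1 = n :=
    ⟨⟨n - i.1, by grind⟩, by grind⟩
  rw [mrange_eq] at hs ⊢
  refine conj_mem_closure hh ?_ hs
  rintro _ ⟨i | i, rfl⟩ <;> obtain ⟨j, hij⟩ := exists_refl i
  · refine Submonoid.subset_closure ⟨.b j, ?_⟩
    rw [Function.comp_apply, Function.comp_apply, ha i j hij, mul_mul_cancel_right_of_mul_self hh]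
  · refine Submonoid.subset_closure ⟨.a j, ?_⟩
    rw [Function.comp_apply, Function.comp_apply, mul_assoc, ← ha j i (by omega),
      mul_mul_cancel_left_of_mul_self hh]

/- A common value `u = v h` forces `v` to be constant, so `v = a₁ⁿ⁻¹ v`, and then `N₂` rewrites
`v h = a₁ⁿ⁻¹ h (h v h)` as `bₙ₋₁ⁿ⁻¹ (h v h)`. -/
lemma mul_mem_mrange (hn : 2 ≤ n) (hR : DefinedBy (evalAB n) R) (hf : Satisfies f (relsBar R))
    (hι : ∀ x, ι (evalAB n x) = f (.ab x)) {u v : OrdInt n}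
    (huv : toMonInt n u = toMonInt n v * evalC n .h) : ι v * f .h ∈ MonoidHom.mrange ι := by
  obtain ⟨-, hh, -, ha_pow⟩ := satisfies_relsBar_iff.1 hf
  let i : Idx n := ⟨1, by grind⟩
  let j : Idx n := ⟨n - 1, by grind⟩
  have ι_mul_h : ι v * f .h = ι (evalAB n (.b j)) ^ (n - 1) * (f .h * ι v * f .h) := calc
    ι v * f .h = ι (evalAB n (.a i) ^ (n - 1) * v) * f .h := by
      rw [mul_eq_self_of_toMonInt_eq_mul huv]
    _ = f (.ab (.a i)) ^ (n - 1) * f .h * (f .h * ι v * f .h) := by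
      simp only [map_mul, map_pow, hι, mul_assoc, mul_mul_cancel_left_of_mul_self hh]
    _ = ι (evalAB n (.b j)) ^ (n - 1) * (f .h * ι v * f .h) := by
      rw [ha_pow i j rfl (by grind), hι]
  rw [ι_mul_h]
  exact mul_mem (pow_mem (MonoidHom.mem_mrange.2 ⟨_, rfl⟩) _) (conj_mem_mrange hR hf hι ⟨v, rfl⟩)

lemma definedBy_relsBar (hn : 2 ≤ n) (hR : DefinedBy (evalAB n) R) :
    DefinedBy (evalC n) (relsBar R) := by
  have hf := satisfies_of (relsBar R)
  obtain ⟨hfR, hh, -, -⟩ := satisfies_relsBar_iff.1 hf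
  obtain ⟨ι, hι⟩ := hR.exists_hom hfR
  let φ := hR.satisfies.evalC_relsBar.lift
  have φ_comp_ι (u : OrdInt n) : φ (ι u) = toMonInt n u := DFunLike.congr_fun
    (MonoidHom.eq_of_eqOn_denseM hR.closure_range (f := φ.comp ι) (g := toMonInt n) <| by
      rintro _ ⟨x, rfl⟩
      exact congrArg φ (hι x)) u
  have mem_or (s : Presented (relsBar R)) :
      s ∈ MonoidHom.mrange ι ∨ s * PresentedMonoid.of _ .h ∈ MonoidHom.mrange ι := by
    refine mem_or_mul_mem hh (fun s => conj_mem_mrange hR hf hι) ?_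
    refine Submonoid.closure_mono ?_ (PresentedMonoid.closure_range_of _ ▸ Submonoid.mem_top s)
    rintro _ ⟨x | _, rfl⟩
    · exact Or.inl ⟨_, hι x⟩
    · exact Or.inr rfl
  refine hR.satisfies.evalC_relsBar.definedBy ⟨injective_of_injOn hh mem_or ?_ ?_, fun f => ?_⟩
  · rintro _ ⟨u, rfl⟩ _ ⟨v, rfl⟩ huv
    rw [φ_comp_ι, φ_comp_ι] at huv
    rw [Submonoid.inclusion_injective _ huv]
  · rintro _ ⟨u, rfl⟩ _ ⟨v, rfl⟩ huv
    rw [map_mul, φ_comp_ι, φ_comp_ι] at huv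
    exact mul_mem_mrange hn hR hf hι huv
  · obtain ⟨g, rfl | rfl⟩ := monInt_eq_or f
    · exact ⟨ι g, φ_comp_ι g⟩
    · exact ⟨ι g * PresentedMonoid.of _ .h, by rw [map_mul, φ_comp_ι]; rfl⟩

end DefinedByRelsBar

section Counting

variable {n : ℕ}

lemma aFn_injective : Function.Injective (aFn (n := n)) := by
  have le_of_eq {i j : Idx n} (h : aFn i = aFn j) : j ≤ i := by
    have h_apply := congrArg Subtype.val (congrFun h ⟨i.1 + 1, by grind⟩)
    simp only [aFn_val] at h_apply
    refine Subtype.coe_le_coe.1 ?_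
    grind
  exact fun i j h => le_antisymm (le_of_eq h.symm) (le_of_eq h)

lemma bFn_injective : Function.Injective (bFn (n := n)) := by
  have le_of_eq {i j : Idx n} (h : bFn i = bFn j) : i ≤ j := by
    have h_apply := congrArg Subtype.val (congrFun h ⟨i.1, by grind⟩)
    simp only [bFn_val] at h_apply
    refine Subtype.coe_le_coe.1 ?_
    grind
  exact fun i j h => le_antisymm (le_of_eq h) (le_of_eq h.symm)

lemma evalC_injective (hn : 2 ≤ n) : Function.Injective (evalC n) := by
  let one : Chain n := ⟨1, by grind⟩
  let top : Chain n := ⟨n, by grind⟩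
  have val_eq {x y : GenC n} (h : evalC n x = evalC n y) (z : Chain n) :
      (toFn (evalC n x).1 z).1 = (toFn (evalC n y).1 z).1 := by rw [h]
  have a_one (i : Idx n) : (toFn (evalC n (.ab (.a i))).1 one).1 = 1 := if_pos i.2.1
  have a_top (i : Idx n) : (toFn (evalC n (.ab (.a i))).1 top).1 = n - 1 :=
    if_neg (not_le.2 i.2.2)
  have b_top (i : Idx n) : (toFn (evalC n (.ab (.b i))).1 top).1 = n := if_neg (not_le.2 i.2.2)
  have h_one : (toFn (evalC n .h).1 one).1 = n := Nat.add_sub_cancel (n := n) (m := 1)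
  have h_top : (toFn (evalC n .h).1 top).1 = 1 := Nat.add_sub_cancel_left (n := n) (m := 1)
  rintro ((i | i) | _) ((j | j) | _) h
  · rw [aFn_injective (congrArg (fun f : MonInt n => toFn f.1) h)]
  · grind
  · grind
  · grind
  · rw [bFn_injective (congrArg (fun f : MonInt n => toFn f.1) h)]
  all_goals grind

lemma card_idx : Nat.card (Idx n) = n - 1 := by
  simp

lemma card_genC (hn : 2 ≤ n) : Nat.card (GenC n) = 2 * n - 1 := by
  let e : (Idx n ⊕ Idx n) ⊕ Unit ≃ GenC n :=
    { toFun := Sum.elim (fun x => .ab (Sum.elim .a .b x)) fun _ => .h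
      invFun := fun
        | .ab (.a i) => .inl (.inl i)
        | .ab (.b i) => .inl (.inr i)
        | .h => .inr ()
      left_inv := by rintro ((i | i) | _) <;> rfl
      right_inv := by rintro ((i | i) | _) <;> rfl }
  rw [← Nat.card_congr e, Nat.card_sum, Nat.card_sum, card_idx, Nat.card_unique]
  omega

/-- The number of occurrences of `h` in a word. -/
def hDegree (n : ℕ) : FreeMonoid (GenC n) →* Multiplicative ℕ :=
  FreeMonoid.lift fun
    | .ab _ => 1
    | .h => Multiplicative.ofAdd 1

lemma hDegree_liftWord (w : FreeMonoid (GenAB n)) : hDegree n (liftWord w) = 1 := by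
  have comp_map : (hDegree n).comp (FreeMonoid.map GenC.ab) = 1 := FreeMonoid.hom_eq fun _ => rfl
  exact DFunLike.congr_fun comp_map w

lemma disjoint_of_forall_eq {X Y : Type} {f : X → Y} {s t : Set X} {c d : Y}
    (hs : ∀ x ∈ s, f x = c) (ht : ∀ x ∈ t, f x = d) (hcd : c ≠ d) : Disjoint s t :=
  Set.disjoint_left.2 fun x hxs hxt => hcd ((hs x hxs).symm.trans (ht x hxt))

lemma encard_N1 : (N1 n).encard = (n - 1 : ℕ) := by
  let relation (i : Idx n) : FreeMonoid (GenC n) × FreeMonoid (GenC n) :=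
    (wh n * liftWord (wa i), liftWord (wb ⟨n - i.1, by grind⟩) * wh n)
  have range_eq : Set.range relation = N1 n := by
    ext p
    constructor
    · rintro ⟨i, rfl⟩
      exact ⟨i, _, by grind, rfl⟩
    · rintro ⟨i, j, hij, rfl⟩
      have j_eq : ⟨n - i.1, by grind⟩ = j := Subtype.ext (by grind)
      exact ⟨i, by simp only [relation, j_eq]⟩
  have relation_injective : Function.Injective relation := fun i j h => by
    have word_eq : [GenC.h, .ab (.a i)] = [.h, .ab (.a j)] := congrArg Prod.fst h
    simpa using word_eq
  rw [← range_eq, ← Set.image_univ, relation_injective.encard_image, Set.encard_univ,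
    ENat.card_eq_coe_natCard, card_idx]

lemma encard_N2 (hn : 2 ≤ n) : (N2 n).encard = 1 := by
  let one : Idx n := ⟨1, by grind⟩
  let last : Idx n := ⟨n - 1, by grind⟩
  refine Set.encard_eq_one.2 ⟨(liftWord (wa one) ^ (n - 1) * wh n, liftWord (wb last) ^ (n - 1)),
    Set.eq_singleton_iff_unique_mem.2 ⟨⟨one, last, rfl, by grind, rfl⟩, ?_⟩⟩
  rintro _ ⟨i, j, hi, hj, rfl⟩
  rw [show i = one from Subtype.ext hi, show j = last from Subtype.ext (by grind)]

lemma encard_relsBar (hn : 2 ≤ n) (R : Rels (GenAB n)) :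
    (relsBar R).encard = R.encard + (n + 1) := by
  let deg (p : FreeMonoid (GenC n) × FreeMonoid (GenC n)) := (hDegree n p.1, hDegree n p.2)
  have hDegree_wh : hDegree n (wh n) = Multiplicative.ofAdd 1 := rfl
  have deg_R : ∀ p ∈ Prod.map liftWord liftWord '' R, deg p = 1 := by
    rintro _ ⟨p, -, rfl⟩
    exact Prod.ext (hDegree_liftWord _) (hDegree_liftWord _)
  have deg_N0 : ∀ p ∈ N0 n, deg p = (Multiplicative.ofAdd 2, 1) := by
    rintro _ rfl
    rfl
  have deg_N1 : ∀ p ∈ N1 n, deg p = (Multiplicative.ofAdd 1, Multiplicative.ofAdd 1) := by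
    rintro _ ⟨i, j, -, rfl⟩
    rfl
  have deg_N2 : ∀ p ∈ N2 n, deg p = (Multiplicative.ofAdd 1, 1) := by
    rintro _ ⟨i, j, -, -, rfl⟩
    simp only [deg, map_mul, map_pow, hDegree_liftWord, one_pow, one_mul, hDegree_wh]
  have liftWord_injective : Function.Injective (liftWord (n := n)) :=
    List.map_injective_iff.2 fun _ _ => GenC.ab.inj
  rw [relsBar, Set.encard_union_eq, Set.encard_union_eq, Set.encard_union_eq,
    (Prod.map_injective.2 ⟨liftWord_injective, liftWord_injective⟩).encard_image, N0,
    Set.encard_singleton, encard_N1, encard_N2 hn]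
  · obtain ⟨m, rfl⟩ := Nat.exists_eq_add_of_le' hn
    push_cast
    ring
  · exact disjoint_of_forall_eq deg_R deg_N0 (by decide)
  · exact (disjoint_of_forall_eq deg_R deg_N1 (by decide)).union_left
      (disjoint_of_forall_eq deg_N0 deg_N1 (by decide))
  · exact ((disjoint_of_forall_eq deg_R deg_N2 (by decide)).union_left
      (disjoint_of_forall_eq deg_N0 deg_N2 (by decide))).union_left
      (disjoint_of_forall_eq deg_N1 deg_N2 (by decide))

/-- The pairs `i < j` of indices. -/
abbrev IdxLT (n : ℕ) : Type := {q : Idx n × Idx n // q.1.1 < q.2.1}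

lemma card_idxLT : Nat.card (IdxLT n) = (n - 1).choose 2 := by
  rw [← card_idx, Nat.card_eq_fintype_card, Nat.card_eq_fintype_card, Fintype.card_subtype]
  exact Fintype.card_product_filter_lt

/-- The relations in `relsAB n`, indexed without repetition in the order of their definition: each
of the three commutation rules contributes one relation for every pair `i < j`, each of the four
rules for `a_{n-1}`, `b_1`, `b_{n-1}`, `a_1` as second letter contributes one for every index. -/
def relationAB (hn : 2 ≤ n) :
    (((((IdxLT n ⊕ Idx n) ⊕ IdxLT n) ⊕ Idx n) ⊕ IdxLT n) ⊕ Idx n) ⊕ Idx n →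
      FreeMonoid (GenAB n) × FreeMonoid (GenAB n)
  | .inl (.inl (.inl (.inl (.inl (.inl ⟨(i, j), hij⟩))))) =>
    (wa i * wa ⟨j.1 - 1, by grind⟩, wa j * wa i)
  | .inl (.inl (.inl (.inl (.inl (.inr i))))) => (wa i * wa ⟨n - 1, by grind⟩, wa i)
  | .inl (.inl (.inl (.inl (.inr ⟨(i, j), hij⟩)))) =>
    (wb j * wb ⟨i.1 + 1, by grind⟩, wb i * wb j)
  | .inl (.inl (.inl (.inr i))) => (wb i * wb ⟨1, by grind⟩, wb i)
  | .inl (.inl (.inr ⟨(i, j), _⟩)) => (wa j * wb i, wb i * wa j)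
  | .inl (.inr i) => (wa i * wb ⟨n - 1, by grind⟩, wb i)
  | .inr i => (wb i * wa ⟨1, by grind⟩, wa i)

lemma of_mul_of_inj {α : Type} {x y x' y' : α} :
    FreeMonoid.of x * FreeMonoid.of y = FreeMonoid.of x' * FreeMonoid.of y' ↔ x = x' ∧ y = y' := by
  change [x, y] = [x', y'] ↔ _
  simp

lemma relationAB_injective (hn : 2 ≤ n) : Function.Injective (relationAB hn) := by
  rintro ((((((⟨⟨i, j⟩, hij⟩ | i) | ⟨⟨i, j⟩, hij⟩) | i) | ⟨⟨i, j⟩, hij⟩) | i) | i)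
    ((((((⟨⟨k, l⟩, hkl⟩ | k) | ⟨⟨k, l⟩, hkl⟩) | k) | ⟨⟨k, l⟩, hkl⟩) | k) | k) h <;>
  replace h := of_mul_of_inj.1 (congrArg Prod.fst h) <;>
  grind

lemma relationAB_mem_relsAB (hn : 2 ≤ n) : ∀ x, relationAB hn x ∈ relsAB n := by
  rintro ((((((⟨⟨i, j⟩, hij⟩ | i) | ⟨⟨i, j⟩, hij⟩) | i) | ⟨⟨i, j⟩, hij⟩) | i) | i)
  · exact .inl (.inl (.inl (.inl (.inl (.inl ⟨i, _, j, by grind, by grind, rfl⟩)))))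
  · exact .inl (.inl (.inl (.inl (.inl (.inr ⟨i, _, by grind, rfl⟩)))))
  · exact .inl (.inl (.inl (.inl (.inr ⟨j, _, i, by grind, by grind, rfl⟩))))
  · exact .inl (.inl (.inl (.inr ⟨i, _, rfl, rfl⟩)))
  · exact .inl (.inl (.inr ⟨j, i, hij, rfl⟩))
  · exact .inl (.inr ⟨i, _, by grind, rfl⟩)
  · exact .inr ⟨i, _, rfl, rfl⟩

lemma range_relationAB (hn : 2 ≤ n) : Set.range (relationAB hn) = relsAB n := by
  refine (Set.range_subset_iff.2 (relationAB_mem_relsAB hn)).antisymm ?_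
  rintro _ ((((((⟨i, j, k, hij, hjk, rfl⟩ | ⟨i, j, hj, rfl⟩) | ⟨i, j, k, hij, hjk, rfl⟩) |
    ⟨i, j, hj, rfl⟩) | ⟨i, j, hij, rfl⟩) | ⟨i, j, hj, rfl⟩) | ⟨i, j, hj, rfl⟩)
  · exact ⟨.inl (.inl (.inl (.inl (.inl (.inl ⟨(i, k), by grind⟩))))), by grind [relationAB]⟩
  · exact ⟨.inl (.inl (.inl (.inl (.inl (.inr i))))), by grind [relationAB]⟩
  · exact ⟨.inl (.inl (.inl (.inl (.inr ⟨(k, i), by grind⟩)))), by grind [relationAB]⟩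
  · exact ⟨.inl (.inl (.inl (.inr i))), by grind [relationAB]⟩
  · exact ⟨.inl (.inl (.inr ⟨(j, i), hij⟩)), rfl⟩
  · exact ⟨.inl (.inr i), by grind [relationAB]⟩
  · exact ⟨.inr i, by grind [relationAB]⟩

lemma encard_relsAB (hn : 2 ≤ n) :
    (relsAB n).encard = (3 * (n - 1).choose 2 + 4 * (n - 1) : ℕ) := by
  rw [← range_relationAB hn, ← Set.image_univ, (relationAB_injective hn).encard_image,
    Set.encard_univ, ENat.card_eq_coe_natCard]
  simp only [Nat.card_sum, card_idxLT, card_idx]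
  congr 1
  ring

lemma two_mul_ncard_relsBar (hn : 2 ≤ n) : 2 * (relsBar (relsAB n)).ncard = 3 * n ^ 2 + n := by
  obtain ⟨m, rfl⟩ := Nat.exists_eq_add_of_le' hn
  have choose_two : (m + 1) * m = (m + 1).choose 2 * 2 := by
    simpa using Nat.add_one_mul_choose_eq m 1
  have encard_eq : (relsBar (relsAB (m + 2))).encard =
      (3 * (m + 1).choose 2 + 4 * (m + 1) + (m + 2 + 1) : ℕ) := by
    rw [encard_relsBar hn, encard_relsAB hn]
    norm_cast
  rw [Set.ncard, encard_eq, ENat.toNat_natCast]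
  linarith

end Counting

end IntervalMonoids

open IntervalMonoids in
theorem theorem8 (n : ℕ) (hn : 2 ≤ n) :
    -- the alphabet `C` has `2n - 1` letters, which name distinct elements of `MonInt n`
    Nat.card (GenC n) = 2 * n - 1 ∧ Function.Injective (evalC n) ∧
    -- the explicit relations `R` present `OrdInt n`, and with `N₀`, `N₁`, `N₂` they present `MonInt n`
    DefinedBy (evalAB n) (relsAB n) ∧
    DefinedBy (evalC n) (relsBar (relsAB n)) ∧
    2 * (relsBar (relsAB n)).ncard = 3 * n ^ 2 + n ∧
    -- the same extension works for every presentation of `OrdInt n` on `A ∪ B`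
    (∀ R : Rels (GenAB n), DefinedBy (evalAB n) R →
      DefinedBy (evalC n) (relsBar R) ∧ (relsBar R).encard = R.encard + (n + 1)) :=
  ⟨card_genC hn, evalC_injective hn, definedBy_relsAB hn,
    definedBy_relsBar hn (definedBy_relsAB hn), two_mul_ncard_relsBar hn,
    fun R hR => ⟨definedBy_relsBar hn hR, encard_relsBar hn R⟩⟩
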